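/- Let $a,b>0$ and let $E$ be the ellipse $(x/a)^2+(y/b)^2=1$. A 3-periodic of the elliptic billiard $E$ is a triple $P_1,P_2,P_3$ of distinct points of $E$ such that at each $P_i$ the path $P_{i-1}P_iP_{i+1}$ (indices modulo 3) obeys the law of reflection in the tangent of $E$ at $P_i$. For a triangle $P_1P_2P_3$ let $s_i$ be the length of the side opposite to $P_i$. The point with trilinear coordinates $x:y:z$ is $(s_1xP_1+s_2yP_2+s_3zP_3)/D$ with $D=s_1x+s_2y+s_3z$. $X_{88}$ and $X_{162}$ are the points whose first trilinear coordinates are $$\frac1{s_2+s_3-2s_1}\qquad\text{and}\qquad \frac1{(s_2^2-s_3^2)(s_2^2+s_3^2-s_1^2)}$$ respectively, the other two being obtained by cyclic permutation. Trilinears matter only up to a common factor, and each triple is multiplied by the product of its three denominators, so that it also makes sense when a denominator vanishes: the first coordinates become $(s_3+s_1-2s_2)(s_1+s_2-2s_3)$ and $(s_3^2-s_1^2)(s_3^2+s_1^2-s_2^2)(s_1^2-s_2^2)(s_1^2+s_2^2-s_3^2)$. Let $N_{88},D_{88}$ and $N_{162},D_{162}$ be the numerators and denominators in the formula for the points with these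 cleared coordinates; the point is well defined if its $D$ is nonzero. (1) Let $a\ne b$. For every 3-periodic of $E$, the points $X_{88}$ and $X_{162}$ are well defined, lie on $E$, and $X_{88}\ne X_{162}$. Consequently their paths never cross: if $P_1(t)P_2(t)P_3(t)$, $t\in\mathbb R$, are 3-periodics with $P_1(t)=(a\cos t,b\sin t)$, then the curves $t\mapsto(t,X_{88}(t))$ and $t\mapsto(t,X_{162}(t))$ are disjoint. (2) A non-degenerate triangle satisfies the cleared equation $D_{162}N_{88}=D_{88}N_{162}$ of $X_{88}=X_{162}$ if and only if it is equilateral. For every non-equilateral triangle, $X_{88}$ and $X_{162}$ are well defined and distinct. (3) For $a,b>0$, if some 3-periodic of $E$ is an equilateral triangle, then $a=b$. -/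

import Mathlib

/-- The Euclidean plane. -/
abbrev Plane : Type := EuclideanSpace ℝ (Fin 2)

namespace EllipticBilliard

/-- The boundary `(x/a)² + (y/b)² = 1` of the elliptic billiard with semi-axes `a`, `b`. -/
def ellipse (a b : ℝ) : Set Plane :=
  {p | (p 0 / a) ^ 2 + (p 1 / b) ^ 2 = 1}

/-- A normal vector to the ellipse at its point `p` (half the gradient of the equation). -/
noncomputable def normal (a b : ℝ) (p : Plane) : Plane :=
  !₂[p 0 / a ^ 2, p 1 / b ^ 2]

/-- The unit vector pointing from `p` to `q` (for `p ≠ q`). -/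
noncomputable def direction (p q : Plane) : Plane :=
  ‖q - p‖⁻¹ • (q - p)

/-- The billiard law at the boundary point `q`: a particle that arrives from `p` is reflected
in the tangent line at `q` and leaves towards `r`. -/
def Reflects (a b : ℝ) (p q r : Plane) : Prop :=
  (Submodule.span ℝ {normal a b q})ᗮ.reflection (direction p q) = direction q r

/-- A 3-periodic of the elliptic billiard: three distinct boundary points, visited cyclically,
with the reflection law at each of them (indices are modulo 3). -/
structure IsThreePeriodic (a b : ℝ) (P : Fin 3 → Plane) : Prop where
  mem_ellipse : ∀ i, P i ∈ ellipse a b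
  injective : Function.Injective P
  reflects : ∀ i, Reflects a b (P (i - 1)) (P i) (P (i + 1))

/-- The point `(a cos t, b sin t)` of the ellipse. -/
noncomputable def ellipsePoint (a b t : ℝ) : Plane :=
  !₂[a * Real.cos t, b * Real.sin t]

/-- A parametrization of 3-periodics by their leading vertex `P₁(t) = (a cos t, b sin t)`. -/
def IsThreePeriodicFamily (a b : ℝ) (P : ℝ → Fin 3 → Plane) : Prop :=
  ∀ t, IsThreePeriodic a b (P t) ∧ P t 0 = ellipsePoint a b t

/-- The length of the side opposite to the vertex `P i`. -/
noncomputable def sideLength (P : Fin 3 → Plane) (i : Fin 3) : ℝ :=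
  dist (P (i + 1)) (P (i + 2))

/-- The trilinear coordinates `h(s₁,s₂,s₃) : h(s₂,s₃,s₁) : h(s₃,s₁,s₂)` given by a triangle
center function `h`. -/
noncomputable def trilinear (h : ℝ → ℝ → ℝ → ℝ) (P : Fin 3 → Plane) (i : Fin 3) : ℝ :=
  h (sideLength P i) (sideLength P (i + 1)) (sideLength P (i + 2))

/-- The numerator `s₁ x P₁ + s₂ y P₂ + s₃ z P₃` of the conversion of trilinears `x : y : z` to
Cartesian coordinates. -/
noncomputable def centerNum (h : ℝ → ℝ → ℝ → ℝ) (P : Fin 3 → Plane) : Plane :=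
  ∑ i, (sideLength P i * trilinear h P i) • P i

/-- The denominator `D = s₁ x + s₂ y + s₃ z` of that conversion. -/
noncomputable def centerDen (h : ℝ → ℝ → ℝ → ℝ) (P : Fin 3 → Plane) : ℝ :=
  ∑ i, sideLength P i * trilinear h P i

/-- The point with trilinears `x : y : z`; it is meaningful when `centerDen h P ≠ 0`. -/
noncomputable def center (h : ℝ → ℝ → ℝ → ℝ) (P : Fin 3 → Plane) : Plane :=
  (centerDen h P)⁻¹ • centerNum h P

/-- Triangle center function of `X₈₈`. The first trilinear of `X₈₈` is `1/(s₂+s₃-2s₁)`; as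
trilinears matter only up to a common factor, the denominators are cleared, so that triangles
for which one of them vanishes are covered too. -/
def h88 (s₁ s₂ s₃ : ℝ) : ℝ :=
  (s₃ + s₁ - 2 * s₂) * (s₁ + s₂ - 2 * s₃)

/-- Triangle center function of `X₁₆₂`. The first trilinear of `X₁₆₂` is
`1/((s₂²-s₃²)(s₂²+s₃²-s₁²))`; again the denominators are cleared. -/
def h162 (s₁ s₂ s₃ : ℝ) : ℝ :=
  ((s₃ ^ 2 - s₁ ^ 2) * (s₃ ^ 2 + s₁ ^ 2 - s₂ ^ 2)) *
    ((s₁ ^ 2 - s₂ ^ 2) * (s₁ ^ 2 + s₂ ^ 2 - s₃ ^ 2))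

/-- Clearing denominators multiplies all three trilinears of `X₈₈` by the same factor. -/
theorem h88_eq (s₁ s₂ s₃ : ℝ) (h₁ : s₂ + s₃ - 2 * s₁ ≠ 0) :
    h88 s₁ s₂ s₃ = ((s₂ + s₃ - 2 * s₁) * (s₃ + s₁ - 2 * s₂) * (s₁ + s₂ - 2 * s₃)) *
      (1 / (s₂ + s₃ - 2 * s₁)) := by
  unfold h88
  rw [mul_one_div, eq_div_iff h₁]
  ring

/-- Clearing denominators multiplies all three trilinears of `X₁₆₂` by the same factor. -/
theorem h162_eq (s₁ s₂ s₃ : ℝ)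
    (h₁ : (s₂ ^ 2 - s₃ ^ 2) * (s₂ ^ 2 + s₃ ^ 2 - s₁ ^ 2) ≠ 0) :
    h162 s₁ s₂ s₃ =
      (((s₂ ^ 2 - s₃ ^ 2) * (s₂ ^ 2 + s₃ ^ 2 - s₁ ^ 2)) *
        ((s₃ ^ 2 - s₁ ^ 2) * (s₃ ^ 2 + s₁ ^ 2 - s₂ ^ 2)) *
        ((s₁ ^ 2 - s₂ ^ 2) * (s₁ ^ 2 + s₂ ^ 2 - s₃ ^ 2))) *
      (1 / ((s₂ ^ 2 - s₃ ^ 2) * (s₂ ^ 2 + s₃ ^ 2 - s₁ ^ 2))) := by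
  unfold h162
  rw [mul_one_div, eq_div_iff h₁]
  ring

/-- The triangle center `X₈₈`. -/
noncomputable def X88 (P : Fin 3 → Plane) : Plane := center h88 P

/-- The triangle center `X₁₆₂`. -/
noncomputable def X162 (P : Fin 3 → Plane) : Plane := center h162 P

/-- The center with center function `h` is a well-defined finite point for the triangle `P`. -/
def CenterDefined (h : ℝ → ℝ → ℝ → ℝ) (P : Fin 3 → Plane) : Prop :=
  centerDen h P ≠ 0

/-- The equation `X₈₈ = X₁₆₂` in Cartesian coordinates, with denominators cleared. -/
def CoincidenceEquation (P : Fin 3 → Plane) : Prop :=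
  centerDen h162 P • centerNum h88 P = centerDen h88 P • centerNum h162 P

end EllipticBilliard

namespace EllipticBilliard

/-! The cleared trilinears are `vw : wu : uv` for `X₈₈` and `VW : WU : UV` for `X₁₆₂`, where the
original denominators satisfy `u + v + w = 0` and `U + V + W = 0`. If the points coincide,
uniqueness of barycentric coordinates makes these triples proportional, so the minor `uV - vU`
vanishes (`coincidencePoly_eq_zero`). But for a non-equilateral triangle both center denominators
are negative and this minor is positive (`center_polys`).

For the billiard, use the inner product whose unit circle is `E`. The reflection law makes `1 - ⟨Pᵢ,
Pⱼ⟩` proportional to `|PᵢPⱼ|` (`IsThreePeriodic.exists_conjugacy_eq`). Hence `E` has trilinear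
equation `yz + zx + xy = 0`, which the zero sums above give for both centers. Three points of `E`
are never collinear, and an equilateral 3-periodic forces `a = b`, so the triangle statement
applies. -/

/-! ### Polynomial inequalities in the side lengths -/

/-- The denominator of `X₈₈` as a polynomial in the side lengths. -/
def den88 (a b c : ℝ) : ℝ := a * h88 a b c + b * h88 b c a + c * h88 c a b

/-- The denominator of `X₁₆₂` as a polynomial in the side lengths. -/
def den162 (a b c : ℝ) : ℝ := a * h162 a b c + b * h162 b c a + c * h162 c a b

/-- This polynomial in the side lengths vanishes when the reciprocal trilinears of `X₈₈` and `X₁₆₂`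
are proportional. -/
def coincidencePoly (a b c : ℝ) : ℝ :=
  (b + c - 2 * a) * ((c ^ 2 - a ^ 2) * (c ^ 2 + a ^ 2 - b ^ 2)) -
    (c + a - 2 * b) * ((b ^ 2 - c ^ 2) * (b ^ 2 + c ^ 2 - a ^ 2))

/-- Ravi substitution for the side lengths of a sorted non-equilateral triangle. -/
theorem exists_ravi {a b c : ℝ} (hcb : c ≤ b) (hba : b ≤ a) (ht : a < b + c)
    (hne : ¬ (a = b ∧ b = c)) :
    ∃ x p q : ℝ, 0 < x ∧ 0 ≤ p ∧ 0 ≤ q ∧ 0 < p ^ 2 + p * q + q ^ 2 ∧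
      a = (x + p) + (x + p + q) ∧ b = (x + p + q) + x ∧ c = x + (x + p) := by
  -- `x` is the semiperimeter minus the longest side; `p` and `q` are the gaps between consecutive
  -- sides.
  refine ⟨(b + c - a) / 2, a - b, b - c, by linarith, by linarith, by linarith, ?_,
    by ring, by ring, by ring⟩
  rcases hba.lt_or_eq with h | h
  · have h1 : 0 < a - b := by linarith
    have h2 : 0 ≤ b - c := by linarith
    positivity
  · have h1 : 0 ≤ a - b := by linarith
    have h2 : 0 < b - c := by
      rcases hcb.lt_or_eq with h' | h'
      · linarith
      · exact absurd ⟨h.symm, h'.symm⟩ hne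
    positivity

/-- The denominator of `X₈₈` is negative for a sorted non-equilateral triangle. -/
theorem den88_neg_of_le {a b c : ℝ} (hcb : c ≤ b) (hba : b ≤ a)
    (ht : a < b + c) (hne : ¬ (a = b ∧ b = c)) :
    den88 a b c < 0 := by
  obtain ⟨x, p, q, hx, hp, hq, hpq, rfl, rfl, rfl⟩ := exists_ravi hcb hba ht hne
  -- This is `-den88` expanded: no coefficient is negative, and the block split off in front is
  -- strictly positive.
  have h : 0 < 6 * x * (p ^ 2 + p * q + q ^ 2) + (
        2 * p ^ 3 + 3 * p ^ 2 * q + 9 * p * q ^ 2 + 4 * q ^ 3) := by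
    positivity
  unfold den88 h88
  linarith

/-- The denominator of `X₁₆₂` is negative for a sorted non-equilateral triangle. -/
theorem den162_neg_of_le {a b c : ℝ} (hcb : c ≤ b) (hba : b ≤ a)
    (ht : a < b + c) (hne : ¬ (a = b ∧ b = c)) :
    den162 a b c < 0 := by
  obtain ⟨x, p, q, hx, hp, hq, hpq, rfl, rfl, rfl⟩ := exists_ravi hcb hba ht hne
  have h : 0 < 512 * x ^ 7 * (p ^ 2 + p * q + q ^ 2) + (
        3328 * x ^ 6 * p ^ 3 + 4992 * x ^ 6 * p ^ 2 * q + 2176 * x ^ 6 * p * q ^ 2 + 256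
        * x ^ 6 * q ^ 3 + 9248 * x ^ 5 * p ^ 4 + 18496 * x ^ 5 * p ^ 3 * q + 10080 * x ^
        5 * p ^ 2 * q ^ 2 + 832 * x ^ 5 * p * q ^ 3 + 32 * x ^ 5 * q ^ 4 + 14240 * x ^ 4
        * p ^ 5 + 35600 * x ^ 4 * p ^ 4 * q + 28640 * x ^ 4 * p ^ 3 * q ^ 2 + 7360 * x ^
        4 * p ^ 2 * q ^ 3 + 80 * x ^ 4 * p * q ^ 4 + 13120 * x ^ 3 * p ^ 6 + 39360 * x ^
        3 * p ^ 5 * q + 43024 * x ^ 3 * p ^ 4 * q ^ 2 + 20448 * x ^ 3 * p ^ 3 * q ^ 3 +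
        3664 * x ^ 3 * p ^ 2 * q ^ 4 + 7232 * x ^ 2 * p ^ 7 + 25312 * x ^ 2 * p ^ 6 * q
        + 34944 * x ^ 2 * p ^ 5 * q ^ 2 + 24080 * x ^ 2 * p ^ 4 * q ^ 3 + 8416 * x ^ 2 *
        p ^ 3 * q ^ 4 + 1200 * x ^ 2 * p ^ 2 * q ^ 5 + 2208 * x * p ^ 8 + 8832 * x * p ^
        7 * q + 14664 * x * p ^ 6 * q ^ 2 + 13080 * x * p ^ 5 * q ^ 3 + 6672 * x * p ^ 4
        * q ^ 4 + 1848 * x * p ^ 3 * q ^ 5 + 216 * x * p ^ 2 * q ^ 6 + 288 * p ^ 9 +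
        1296 * p ^ 8 * q + 2504 * p ^ 7 * q ^ 2 + 2716 * p ^ 6 * q ^ 3 + 1796 * p ^ 5 *
        q ^ 4 + 724 * p ^ 4 * q ^ 5 + 164 * p ^ 3 * q ^ 6 + 16 * p ^ 2 * q ^ 7) := by
    positivity
  unfold den162 h162
  linarith

/-- The coincidence polynomial is positive for a sorted non-equilateral triangle. -/
theorem coincidencePoly_pos_of_le {a b c : ℝ} (hcb : c ≤ b) (hba : b ≤ a)
    (ht : a < b + c) (hne : ¬ (a = b ∧ b = c)) :
    0 < coincidencePoly a b c := by
  obtain ⟨x, p, q, hx, hp, hq, hpq, rfl, rfl, rfl⟩ := exists_ravi hcb hba ht hne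
  have h : 0 < 32 * x ^ 3 * (p ^ 2 + p * q + q ^ 2) + (
        88 * x ^ 2 * p ^ 3 + 132 * x ^ 2 * p ^ 2 * q + 60 * x ^ 2 * p * q ^ 2 + 8 * x ^
        2 * q ^ 3 + 80 * x * p ^ 4 + 160 * x * p ^ 3 * q + 88 * x * p ^ 2 * q ^ 2 + 8 *
        x * p * q ^ 3 + 24 * p ^ 5 + 60 * p ^ 4 * q + 48 * p ^ 3 * q ^ 2 + 12 * p ^ 2 *
        q ^ 3) := by
    positivity
  unfold coincidencePoly
  linarith

/-- All three polynomials are symmetric in the sides, so the sorted case suffices. -/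
theorem center_polys {a b c : ℝ} (ha : a < b + c) (hb : b < c + a) (hc : c < a + b)
    (hne : ¬ (a = b ∧ b = c)) :
    den88 a b c < 0 ∧ den162 a b c < 0 ∧ 0 < coincidencePoly a b c := by
  have key : ∀ x y z : ℝ, z ≤ y → y ≤ x → x < y + z → ¬ (x = y ∧ y = z) →
      den88 a b c = den88 x y z → den162 a b c = den162 x y z →
      coincidencePoly a b c = coincidencePoly x y z →
      den88 a b c < 0 ∧ den162 a b c < 0 ∧ 0 < coincidencePoly a b c := by
    intro x y z h1 h2 h3 h4 h5 h6 h7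
    rw [h5, h6, h7]
    exact ⟨den88_neg_of_le h1 h2 h3 h4, den162_neg_of_le h1 h2 h3 h4,
      coincidencePoly_pos_of_le h1 h2 h3 h4⟩
  rcases le_total a b with h1 | h1 <;> rcases le_total b c with h2 | h2 <;>
    rcases le_total a c with h3 | h3
  · exact key c b a h1 h2 (by linarith) (fun h => hne ⟨h.2.symm, h.1.symm⟩)
      (by unfold den88 h88; ring) (by unfold den162 h162; ring) (by unfold coincidencePoly; ring)
  · exact absurd ⟨by linarith, by linarith⟩ hne
  · exact key b c a h3 h2 (by linarith) (fun h => hne ⟨h.2.symm.trans h.1.symm, h.1⟩)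
      (by unfold den88 h88; ring) (by unfold den162 h162; ring) (by unfold coincidencePoly; ring)
  · exact key b a c h3 h1 (by linarith) (fun h => hne ⟨h.1.symm, h.1.trans h.2⟩)
      (by unfold den88 h88; ring) (by unfold den162 h162; ring) (by unfold coincidencePoly; ring)
  · exact key c a b h1 h3 (by linarith) (fun h => hne ⟨h.2, h.2.symm.trans h.1.symm⟩)
      (by unfold den88 h88; ring) (by unfold den162 h162; ring) (by unfold coincidencePoly; ring)
  · exact key a c b h2 h3 (by linarith) (fun h => hne ⟨h.1.trans h.2, h.2.symm⟩)
      (by unfold den88 h88; ring) (by unfold den162 h162; ring) (by unfold coincidencePoly; ring)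
  · exact absurd ⟨by linarith, by linarith⟩ hne
  · exact key a b c h2 h1 (by linarith) hne rfl rfl rfl

/-- If the trilinears of `X₈₈` and `X₁₆₂` are proportional, the coincidence polynomial vanishes. -/
theorem coincidencePoly_eq_zero {a b c k l : ℝ} (hk : k ≠ 0) (hl : l ≠ 0)
    (h1 : k * h88 a b c = l * h162 a b c) (h2 : k * h88 b c a = l * h162 b c a)
    (h3 : k * h88 c a b = l * h162 c a b) : coincidencePoly a b c = 0 := by
  unfold coincidencePoly
  unfold h88 h162 at h1 h2 h3
  obtain ⟨u, hu⟩ : ∃ u, u = b + c - 2 * a := ⟨_, rfl⟩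
  obtain ⟨v, hv⟩ : ∃ v, v = c + a - 2 * b := ⟨_, rfl⟩
  obtain ⟨w, hw⟩ : ∃ w, w = a + b - 2 * c := ⟨_, rfl⟩
  obtain ⟨U, hU⟩ : ∃ U, U = (b ^ 2 - c ^ 2) * (b ^ 2 + c ^ 2 - a ^ 2) := ⟨_, rfl⟩
  obtain ⟨V, hV⟩ : ∃ V, V = (c ^ 2 - a ^ 2) * (c ^ 2 + a ^ 2 - b ^ 2) := ⟨_, rfl⟩
  obtain ⟨W, hW⟩ : ∃ W, W = (a ^ 2 - b ^ 2) * (a ^ 2 + b ^ 2 - c ^ 2) := ⟨_, rfl⟩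
  have hw' : w = -u - v := by rw [hu, hv, hw]; ring
  have hW' : W = -U - V := by rw [hU, hV, hW]; ring
  rw [← hu, ← hv, ← hU, ← hV]
  rw [← hv, ← hw, ← hV, ← hW] at h1
  rw [← hw, ← hu, ← hW, ← hU] at h2
  rw [← hu, ← hv, ← hU, ← hV] at h3
  clear hu hv hw hU hV hW
  have hkl : k * l ≠ 0 := mul_ne_zero hk hl
  -- Dividing by `u, v, w` is not allowed, as they may vanish. Instead, eliminating between two of
  -- the proportions gives the minor times `u * U`, and cyclically; if the minor is nonzero, all of
  -- `uU`, `vV`, `wW` vanish, and every case makes the minor zero.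
  by_contra hF
  have e1 : u * U = 0 := by
    have : k * l * (u * V - v * U) * (u * U) = 0 := by
      subst hw' hW'
      linear_combination (l * ((-U - V) * U)) * h3 - (l * (U * V)) * h2
    simpa [hkl, hF] using this
  have e2 : v * V = 0 := by
    have : k * l * (u * V - v * U) * (v * V) = 0 := by
      subst hw' hW'
      linear_combination (l * (U * V)) * h1 - (l * (V * (-U - V))) * h3
    simpa [hkl, hF] using this
  have e3 : w * W = 0 := by
    have : k * l * (u * V - v * U) * (w * W) = 0 := by
      subst hw' hW'
      linear_combination (l * (V * (-U - V))) * h2 - (l * ((-U - V) * U)) * h1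
    simpa [hkl, hF] using this
  apply hF
  rcases mul_eq_zero.1 e1 with h | h <;> rcases mul_eq_zero.1 e2 with h' | h' <;>
    simp_all

/-! ### Triangles, their side lengths and their centers -/

variable {P : Fin 3 → Plane} {a b : ℝ}

theorem sideLength_zero (P : Fin 3 → Plane) : sideLength P 0 = dist (P 1) (P 2) := rfl

theorem sideLength_one (P : Fin 3 → Plane) : sideLength P 1 = dist (P 2) (P 0) := rfl

theorem sideLength_two (P : Fin 3 → Plane) : sideLength P 2 = dist (P 0) (P 1) := rfl

theorem trilinear_zero (h : ℝ → ℝ → ℝ → ℝ) (P : Fin 3 → Plane) :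
    trilinear h P 0 = h (sideLength P 0) (sideLength P 1) (sideLength P 2) := rfl

theorem trilinear_one (h : ℝ → ℝ → ℝ → ℝ) (P : Fin 3 → Plane) :
    trilinear h P 1 = h (sideLength P 1) (sideLength P 2) (sideLength P 0) := rfl

theorem trilinear_two (h : ℝ → ℝ → ℝ → ℝ) (P : Fin 3 → Plane) :
    trilinear h P 2 = h (sideLength P 2) (sideLength P 0) (sideLength P 1) := rfl

theorem centerDen_h88 (P : Fin 3 → Plane) :
    centerDen h88 P = den88 (sideLength P 0) (sideLength P 1) (sideLength P 2) := by
  simp [centerDen, Fin.sum_univ_three, trilinear_zero, trilinear_one, trilinear_two, den88]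

theorem centerDen_h162 (P : Fin 3 → Plane) :
    centerDen h162 P = den162 (sideLength P 0) (sideLength P 1) (sideLength P 2) := by
  simp [centerDen, Fin.sum_univ_three, trilinear_zero, trilinear_one, trilinear_two, den162]

theorem sideLength_pos (hP : Function.Injective P) (i : Fin 3) : 0 < sideLength P i :=
  dist_pos.2 fun h => absurd (hP h) (by fin_cases i <;> decide)

/-- The strict triangle inequality. -/
theorem dist_lt_of_affineIndependent (hP : AffineIndependent ℝ P) {i j k : Fin 3}
    (hij : i ≠ j) (hik : i ≠ k) (hjk : j ≠ k) :
    dist (P i) (P k) < dist (P i) (P j) + dist (P j) (P k) := by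
  refine lt_of_le_of_ne (dist_triangle _ _ _) fun h => ?_
  have hw : Wbtw ℝ (P i) (P j) (P k) := dist_add_dist_eq_iff.1 h.symm
  exact (affineIndependent_iff_not_collinear_of_ne hij hik hjk).1 hP hw.collinear

theorem sideLength_triangle (hP : AffineIndependent ℝ P) :
    sideLength P 0 < sideLength P 1 + sideLength P 2 ∧
    sideLength P 1 < sideLength P 2 + sideLength P 0 ∧
    sideLength P 2 < sideLength P 0 + sideLength P 1 := by
  simp only [sideLength_zero, sideLength_one, sideLength_two]
  have h0 := dist_lt_of_affineIndependent hP (i := 1) (j := 0) (k := 2) (by decide) (by decide)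
    (by decide)
  have h1 := dist_lt_of_affineIndependent hP (i := 2) (j := 1) (k := 0) (by decide) (by decide)
    (by decide)
  have h2 := dist_lt_of_affineIndependent hP (i := 0) (j := 2) (k := 1) (by decide) (by decide)
    (by decide)
  rw [dist_comm (P 1) (P 0), dist_comm (P 0) (P 2)] at h0
  rw [dist_comm (P 2) (P 1), dist_comm (P 1) (P 0)] at h1
  rw [dist_comm (P 0) (P 2), dist_comm (P 2) (P 1)] at h2
  exact ⟨by linarith, by linarith, by linarith⟩

theorem equilateral_iff (T : Affine.Triangle ℝ Plane) :
    T.Equilateral ↔ sideLength T.points 0 = sideLength T.points 1 ∧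
      sideLength T.points 1 = sideLength T.points 2 := by
  simp only [sideLength_zero, sideLength_one, sideLength_two]
  constructor
  · intro h
    exact ⟨h.dist_eq (by decide) (by decide), h.dist_eq (by decide) (by decide)⟩
  · rintro ⟨h1, h2⟩
    refine ⟨dist (T.points 0) (T.points 1), fun i j hij => ?_⟩
    fin_cases i <;> fin_cases j <;>
      first
      | exact absurd rfl hij
      | exact rfl
      | exact h2
      | exact h1.trans h2
      | exact dist_comm _ _
      | exact (dist_comm _ _).trans h2
      | exact (dist_comm _ _).trans (h1.trans h2)

theorem centerDen_smul_center {h : ℝ → ℝ → ℝ → ℝ} (hD : centerDen h P ≠ 0) :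
    centerDen h P • center h P = centerNum h P :=
  smul_inv_smul₀ hD _

theorem coincidenceEquation_of_eq (h1 : centerDen h88 P ≠ 0) (h2 : centerDen h162 P ≠ 0)
    (h : X88 P = X162 P) : CoincidenceEquation P := by
  unfold CoincidenceEquation
  rw [← centerDen_smul_center h1, ← centerDen_smul_center h2, smul_comm]
  exact congrArg _ (congrArg _ h)

/-- Barycentric coordinates are unique, so that coinciding points have proportional trilinears. -/
theorem CoincidenceEquation.trilinear_eq (hP : AffineIndependent ℝ P)
    (h : CoincidenceEquation P) (i : Fin 3) :
    centerDen h162 P * trilinear h88 P i = centerDen h88 P * trilinear h162 P i := by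
  have hz := hP.eq_zero_of_sum_eq_zero (s := Finset.univ)
    (w := fun i => sideLength P i * (centerDen h162 P * trilinear h88 P i -
      centerDen h88 P * trilinear h162 P i)) ?_ ?_ i (Finset.mem_univ i)
  · rcases mul_eq_zero.1 hz with h0 | h0
    · exact absurd h0 (sideLength_pos hP.injective i).ne'
    · exact sub_eq_zero.1 h0
  · have e1 : centerDen h162 P * centerDen h88 P =
        centerDen h162 P * ∑ i, sideLength P i * trilinear h88 P i := rfl
    have e2 : centerDen h88 P * centerDen h162 P =
        centerDen h88 P * ∑ i, sideLength P i * trilinear h162 P i := rfl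
    simp only [Fin.sum_univ_three] at e1 e2 ⊢
    linear_combination e2 - e1
  · have e := sub_eq_zero.2 h
    simp only [centerNum, Finset.smul_sum, ← Finset.sum_sub_distrib, smul_smul, ← sub_smul] at e
    rw [← e]
    exact Finset.sum_congr rfl fun i _ => by congr 1; ring

theorem triangle_centers (T : Affine.Triangle ℝ Plane) (hT : ¬ T.Equilateral) :
    CenterDefined h88 T.points ∧ CenterDefined h162 T.points ∧
      ¬ CoincidenceEquation T.points := by
  obtain ⟨t0, t1, t2⟩ := sideLength_triangle T.independent
  rw [equilateral_iff] at hT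
  obtain ⟨h1, h2, h3⟩ := center_polys t0 t1 t2 hT
  rw [← centerDen_h88] at h1
  rw [← centerDen_h162] at h2
  exact ⟨h1.ne, h2.ne, fun h => h3.ne' (coincidencePoly_eq_zero h2.ne h1.ne
    (h.trilinear_eq T.independent 0) (h.trilinear_eq T.independent 1)
    (h.trilinear_eq T.independent 2))⟩

/-- For equilateral triangles all cleared trilinears vanish, so the equation degenerates to `0 = 0`.
-/
theorem coincidenceEquation_iff (T : Affine.Triangle ℝ Plane) :
    CoincidenceEquation T.points ↔ T.Equilateral := by
  refine ⟨fun h => by_contra fun hT => (triangle_centers T hT).2.2 h, fun hT => ?_⟩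
  obtain ⟨h1, h2⟩ := (equilateral_iff T).1 hT
  have e1 : centerDen h88 T.points = 0 := by
    rw [centerDen_h88, h1, h2, den88, h88]; ring
  have e2 : centerDen h162 T.points = 0 := by
    rw [centerDen_h162, h1, h2, den162, h162]; ring
  rw [CoincidenceEquation, e1, e2, zero_smul, zero_smul]

theorem X88_ne_X162 (T : Affine.Triangle ℝ Plane) (hT : ¬ T.Equilateral) :
    CenterDefined h88 T.points ∧ CenterDefined h162 T.points ∧ X88 T.points ≠ X162 T.points := by
  obtain ⟨h1, h2, h3⟩ := triangle_centers T hT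
  exact ⟨h1, h2, fun h => h3 (coincidenceEquation_of_eq h1 h2 h)⟩

/-! ### The reflection law and the inner product of the ellipse -/

/-- The value `1 - ⟨p, q⟩` for the inner product whose unit circle is the ellipse; it vanishes iff
`p` and `q` are conjugate points. -/
noncomputable def conjugacy (a b : ℝ) (p q : Plane) : ℝ := 1 - (p 0 * q 0 / a ^ 2 + p 1 * q 1 / b ^ 2)

theorem conjugacy_comm (a b : ℝ) (p q : Plane) : conjugacy a b p q = conjugacy a b q p := by
  unfold conjugacy; ring

theorem mem_ellipse_iff {p : Plane} :
    p ∈ ellipse a b ↔ p 0 ^ 2 / a ^ 2 + p 1 ^ 2 / b ^ 2 = 1 := by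
  simp [ellipse, div_pow]

theorem two_mul_conjugacy {p q : Plane} (hp : p ∈ ellipse a b) (hq : q ∈ ellipse a b) :
    2 * conjugacy a b p q = (p 0 - q 0) ^ 2 / a ^ 2 + (p 1 - q 1) ^ 2 / b ^ 2 := by
  rw [mem_ellipse_iff] at hp hq
  unfold conjugacy
  linear_combination -hp - hq

theorem conjugacy_pos (ha : 0 < a) (hb : 0 < b) {p q : Plane} (hp : p ∈ ellipse a b)
    (hq : q ∈ ellipse a b) (hpq : p ≠ q) : 0 < conjugacy a b p q := by
  have h := two_mul_conjugacy hp hq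
  have hne : p 0 - q 0 ≠ 0 ∨ p 1 - q 1 ≠ 0 := by
    by_contra! hc
    exact hpq (by ext i; fin_cases i; exacts [sub_eq_zero.1 hc.1, sub_eq_zero.1 hc.2])
  have : 0 < (p 0 - q 0) ^ 2 / a ^ 2 + (p 1 - q 1) ^ 2 / b ^ 2 := by
    rcases hne with hne | hne <;> positivity
  linarith

theorem inner_normal_sub {p : Plane} (hp : p ∈ ellipse a b) (q : Plane) :
    inner ℝ (q - p) (normal a b p) = -conjugacy a b p q := by
  rw [mem_ellipse_iff] at hp
  simp only [normal, conjugacy, PiLp.inner_apply, Fin.sum_univ_two, RCLike.inner_apply,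
    conj_trivial, PiLp.sub_apply]
  simp
  linear_combination -hp

theorem inner_direction {p q : Plane} (v : Plane) :
    inner ℝ (direction p q) v = (dist p q)⁻¹ * inner ℝ (q - p) v := by
  rw [direction, real_inner_smul_left, ← dist_eq_norm, dist_comm]

/-- Reflection in the tangent line reverses the normal component. -/
theorem inner_reflection_normal (v n : Plane) :
    inner ℝ ((Submodule.span ℝ {n})ᗮ.reflection v) n = -inner ℝ v n := by
  have h : (Submodule.span ℝ {n}).reflection n = n :=
    Submodule.reflection_mem_subspace_eq_self (Submodule.mem_span_singleton_self n)
  rw [Submodule.reflection_orthogonal_apply, inner_neg_left]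
  have e := LinearIsometryEquiv.inner_map_map (Submodule.span ℝ {n}).reflection v n
  rw [h] at e
  rw [e]

/-- The reflection law makes the conjugacy of consecutive vertices proportional to their
distance. -/
theorem Reflects.conjugacy_div {p q r : Plane} (hq : q ∈ ellipse a b)
    (h : Reflects a b p q r) :
    conjugacy a b p q / dist p q = conjugacy a b q r / dist q r := by
  have e := inner_reflection_normal (direction p q) (normal a b q)
  rw [show (Submodule.span ℝ {normal a b q})ᗮ.reflection (direction p q) = direction q r from h,
    inner_direction, inner_direction, inner_normal_sub hq, ← neg_sub p q, inner_neg_left,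
    inner_normal_sub hq, conjugacy_comm a b q p] at e
  rw [div_eq_inv_mul, div_eq_inv_mul]
  linarith

/-- Along a 3-periodic the conjugacy of two vertices is a constant multiple of their distance. -/
theorem IsThreePeriodic.exists_conjugacy_eq (ha : 0 < a) (hb : 0 < b)
    (hP : IsThreePeriodic a b P) :
    ∃ k : ℝ, 0 < k ∧ conjugacy a b (P 1) (P 2) = k * sideLength P 0 ∧
      conjugacy a b (P 2) (P 0) = k * sideLength P 1 ∧
      conjugacy a b (P 0) (P 1) = k * sideLength P 2 := by
  have h0 : conjugacy a b (P 2) (P 0) / sideLength P 1 =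
      conjugacy a b (P 0) (P 1) / sideLength P 2 :=
    (hP.reflects 0).conjugacy_div (hP.mem_ellipse _)
  have h1 : conjugacy a b (P 0) (P 1) / sideLength P 2 =
      conjugacy a b (P 1) (P 2) / sideLength P 0 :=
    (hP.reflects 1).conjugacy_div (hP.mem_ellipse _)
  have hs := sideLength_pos hP.injective
  have hk := conjugacy_pos ha hb (hP.mem_ellipse 0) (hP.mem_ellipse 1)
    (hP.injective.ne (by decide))
  refine ⟨conjugacy a b (P 0) (P 1) / sideLength P 2, div_pos hk (hs 2), ?_, ?_, ?_⟩
  · rw [h1, div_mul_cancel₀ _ (hs 0).ne']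
  · rw [← h0, div_mul_cancel₀ _ (hs 1).ne']
  · rw [div_mul_cancel₀ _ (hs 2).ne']

/-- The symmetric matrix with zero diagonal and off-diagonal entries `x, y, z` has determinant
`2xyz`. -/
theorem eq_zero_of_cyclic_sums {x y z w₀ w₁ w₂ : ℝ} (hx : 0 < x) (hy : 0 < y) (hz : 0 < z)
    (h0 : w₁ * z + w₂ * y = 0) (h1 : w₀ * z + w₂ * x = 0) (h2 : w₀ * y + w₁ * x = 0) :
    w₀ = 0 ∧ w₁ = 0 ∧ w₂ = 0 := by
  have e0 : w₀ = 0 := by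
    have : (y * z) * w₀ = 0 := by linear_combination (y * h1 + z * h2 - x * h0) / 2
    simpa [hy.ne', hz.ne'] using this
  have e1 : w₁ = 0 := by simpa [e0, hx.ne'] using h2
  have e2 : w₂ = 0 := by simpa [e0, hx.ne'] using h1
  exact ⟨e0, e1, e2⟩

/-- Three distinct points of an ellipse are not collinear. -/
theorem affineIndependent_of_mem_ellipse (ha : 0 < a) (hb : 0 < b)
    (hE : ∀ i, P i ∈ ellipse a b) (hP : Function.Injective P) : AffineIndependent ℝ P := by
  rw [affineIndependent_iff_of_fintype]
  intro w hw hs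
  rw [Finset.univ.weightedVSub_eq_linear_combination hw] at hs
  have c0 := congrArg (fun v : Plane => v 0) hs
  have c1 := congrArg (fun v : Plane => v 1) hs
  simp only [Fin.sum_univ_three, PiLp.add_apply, PiLp.smul_apply, smul_eq_mul,
    PiLp.zero_apply] at hw c0 c1
  have e0 := mem_ellipse_iff.1 (hE 0)
  have e1 := mem_ellipse_iff.1 (hE 1)
  have e2 := mem_ellipse_iff.1 (hE 2)
  -- Pair the affine relation with each `1 - ⟨P i, ·⟩`; the diagonal entries vanish because `P i`
  -- lies on the ellipse.
  obtain ⟨r0, r1, r2⟩ := eq_zero_of_cyclic_sums (w₀ := w 0) (w₁ := w 1) (w₂ := w 2)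
    (conjugacy_pos ha hb (hE 1) (hE 2) (hP.ne (by decide)))
    (conjugacy_pos ha hb (hE 2) (hE 0) (hP.ne (by decide)))
    (conjugacy_pos ha hb (hE 0) (hE 1) (hP.ne (by decide)))
    (by unfold conjugacy
        linear_combination hw - P 0 0 / a ^ 2 * c0 - P 0 1 / b ^ 2 * c1 + w 0 * e0)
    (by unfold conjugacy
        linear_combination hw - P 1 0 / a ^ 2 * c0 - P 1 1 / b ^ 2 * c1 + w 1 * e1)
    (by unfold conjugacy
        linear_combination hw - P 2 0 / a ^ 2 * c0 - P 2 1 / b ^ 2 * c1 + w 2 * e2)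
  intro i
  fin_cases i
  exacts [r0, r1, r2]

/-- The ellipse is the circumconic of a 3-periodic with trilinear equation `yz + zx + xy = 0`. -/
theorem IsThreePeriodic.center_mem_ellipse (ha : 0 < a) (hb : 0 < b)
    (hP : IsThreePeriodic a b P) {h : ℝ → ℝ → ℝ → ℝ} (hD : centerDen h P ≠ 0)
    (hh : trilinear h P 1 * trilinear h P 2 + trilinear h P 2 * trilinear h P 0 +
      trilinear h P 0 * trilinear h P 1 = 0) : center h P ∈ ellipse a b := by
  obtain ⟨k, -, k0, k1, k2⟩ := hP.exists_conjugacy_eq ha hb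
  have e0 := mem_ellipse_iff.1 (hP.mem_ellipse 0)
  have e1 := mem_ellipse_iff.1 (hP.mem_ellipse 1)
  have e2 := mem_ellipse_iff.1 (hP.mem_ellipse 2)
  -- Expanding the square of the numerator, its defect from `D²` is `2 k s₁ s₂ s₃ (yz + zx + xy)`.
  have key : centerNum h P 0 ^ 2 / a ^ 2 + centerNum h P 1 ^ 2 / b ^ 2 = centerDen h P ^ 2 := by
    simp only [centerNum, centerDen, Fin.sum_univ_three, PiLp.add_apply, PiLp.smul_apply,
      smul_eq_mul]
    unfold conjugacy at k0 k1 k2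
    linear_combination (sideLength P 0 * trilinear h P 0) ^ 2 * e0 +
      (sideLength P 1 * trilinear h P 1) ^ 2 * e1 + (sideLength P 2 * trilinear h P 2) ^ 2 * e2 -
      2 * (sideLength P 1 * trilinear h P 1) * (sideLength P 2 * trilinear h P 2) * k0 -
      2 * (sideLength P 2 * trilinear h P 2) * (sideLength P 0 * trilinear h P 0) * k1 -
      2 * (sideLength P 0 * trilinear h P 0) * (sideLength P 1 * trilinear h P 1) * k2 -
      2 * k * sideLength P 0 * sideLength P 1 * sideLength P 2 * hh
  rw [mem_ellipse_iff]
  simp only [center, PiLp.smul_apply, smul_eq_mul]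
  field_simp
  field_simp at key
  linear_combination key

/-- Both the Euclidean form and that of the ellipse are constant on the sides. If `a ≠ b`, the
squared coordinate differences are then constant too; as the differences sum to zero around the
triangle, they all vanish. -/
theorem eq_of_equilateral (ha : 0 < a) (hb : 0 < b) (hP : IsThreePeriodic a b P)
    (h1 : sideLength P 0 = sideLength P 1) (h2 : sideLength P 1 = sideLength P 2) : a = b := by
  obtain ⟨k, -, k0, k1, k2⟩ := hP.exists_conjugacy_eq ha hb
  have m0 := two_mul_conjugacy (hP.mem_ellipse 1) (hP.mem_ellipse 2)
  have m1 := two_mul_conjugacy (hP.mem_ellipse 2) (hP.mem_ellipse 0)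
  have m2 := two_mul_conjugacy (hP.mem_ellipse 0) (hP.mem_ellipse 1)
  rw [k0, h1, h2] at m0
  rw [k1, h2] at m1
  rw [k2] at m2
  have hd : ∀ p q : Plane, dist p q ^ 2 = (p 0 - q 0) ^ 2 + (p 1 - q 1) ^ 2 := fun p q => by
    rw [EuclideanSpace.dist_sq_eq]
    simp [Fin.sum_univ_two, Real.dist_eq, sq_abs]
  have d0 := hd (P 1) (P 2)
  have d1 := hd (P 2) (P 0)
  have d2 := hd (P 0) (P 1)
  rw [← sideLength_zero, h1, h2] at d0
  rw [← sideLength_one, h2] at d1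
  rw [← sideLength_two] at d2
  have hs := sideLength_pos hP.injective 2
  generalize sideLength P 2 = s at *
  generalize P 0 0 = x0 at *
  generalize P 0 1 = y0 at *
  generalize P 1 0 = x1 at *
  generalize P 1 1 = y1 at *
  generalize P 2 0 = x2 at *
  generalize P 2 1 = y2 at *
  rw [div_eq_mul_inv, div_eq_mul_inv] at m0 m1 m2
  by_contra hab
  have hne : (a ^ 2)⁻¹ - (b ^ 2)⁻¹ ≠ 0 := by
    rw [sub_ne_zero]
    intro h
    exact hab ((sq_eq_sq₀ ha.le hb.le).1 (inv_injective h))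
  have q1 : (x1 - x2) ^ 2 = (x0 - x1) ^ 2 := mul_left_cancel₀ hne (by
    linear_combination m2 - m0 + (b ^ 2)⁻¹ * (d0 - d2))
  have q2 : (x2 - x0) ^ 2 = (x0 - x1) ^ 2 := mul_left_cancel₀ hne (by
    linear_combination m2 - m1 + (b ^ 2)⁻¹ * (d1 - d2))
  have eq_zero : ∀ u v w : ℝ, (v - w) ^ 2 = (u - v) ^ 2 → (w - u) ^ 2 = (u - v) ^ 2 →
      (u - v) ^ 2 = 0 := by
    intro u v w e e'
    have f : (u - v) ^ 2 * (u - v) ^ 2 = 0 := by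
      -- Squaring `g` gives `4t² = t²` for the common square `t`.
      have g : 2 * (v - w) * (w - u) = -(u - v) ^ 2 := by linear_combination -e - e'
      have g' := congrArg (· ^ 2) g
      linear_combination (1 / 3) * g' - (4 / 3) * (w - u) ^ 2 * e - (4 / 3) * (u - v) ^ 2 * e'
    simpa using f
  have z1 := eq_zero _ _ _ q1 q2
  have z2 := eq_zero y0 y1 y2 (by linarith) (by linarith)
  nlinarith

end EllipticBilliard

theorem mainTheorem6 :
    -- no coincidence along 3-periodics of a non-circular elliptic billiard
    (∀ a b : ℝ, 0 < a → 0 < b → a ≠ b →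
      (∀ P : Fin 3 → Plane, EllipticBilliard.IsThreePeriodic a b P →
        EllipticBilliard.CenterDefined EllipticBilliard.h88 P ∧
        EllipticBilliard.CenterDefined EllipticBilliard.h162 P ∧
        EllipticBilliard.X88 P ∈ EllipticBilliard.ellipse a b ∧
        EllipticBilliard.X162 P ∈ EllipticBilliard.ellipse a b ∧
        EllipticBilliard.X88 P ≠ EllipticBilliard.X162 P) ∧
      -- the paths `t ↦ X₈₈(t)`, `t ↦ X₁₆₂(t)`, as curves of time and position, do not meet
      (∀ P : ℝ → Fin 3 → Plane, EllipticBilliard.IsThreePeriodicFamily a b P →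
        Disjoint (Set.univ.graphOn fun t => EllipticBilliard.X88 (P t))
          (Set.univ.graphOn fun t => EllipticBilliard.X162 (P t)))) ∧
    -- among all triangles, exactly the equilateral ones solve the coincidence equation
    (∀ T : Affine.Triangle ℝ Plane,
      (EllipticBilliard.CoincidenceEquation T.points ↔ T.Equilateral) ∧
      (¬ T.Equilateral →
        EllipticBilliard.CenterDefined EllipticBilliard.h88 T.points ∧
        EllipticBilliard.CenterDefined EllipticBilliard.h162 T.points ∧
        EllipticBilliard.X88 T.points ≠ EllipticBilliard.X162 T.points)) ∧
    -- equilateral 3-periodics occur only in circles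
    (∀ a b : ℝ, 0 < a → 0 < b → ∀ T : Affine.Triangle ℝ Plane,
      EllipticBilliard.IsThreePeriodic a b T.points → T.Equilateral → a = b) := by
  have equilateral : ∀ a b : ℝ, 0 < a → 0 < b → ∀ T : Affine.Triangle ℝ Plane,
      EllipticBilliard.IsThreePeriodic a b T.points → T.Equilateral → a = b := by
    intro a b ha hb T hP hT
    obtain ⟨h1, h2⟩ := (EllipticBilliard.equilateral_iff T).1 hT
    exact EllipticBilliard.eq_of_equilateral ha hb hP h1 h2
  have periodic : ∀ a b : ℝ, 0 < a → 0 < b → a ≠ b →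
      ∀ P : Fin 3 → Plane, EllipticBilliard.IsThreePeriodic a b P →
        EllipticBilliard.CenterDefined EllipticBilliard.h88 P ∧
        EllipticBilliard.CenterDefined EllipticBilliard.h162 P ∧
        EllipticBilliard.X88 P ∈ EllipticBilliard.ellipse a b ∧
        EllipticBilliard.X162 P ∈ EllipticBilliard.ellipse a b ∧
        EllipticBilliard.X88 P ≠ EllipticBilliard.X162 P := by
    intro a b ha hb hab P hP
    obtain ⟨h1, h2, h3⟩ := EllipticBilliard.X88_ne_X162
      ⟨P, EllipticBilliard.affineIndependent_of_mem_ellipse ha hb hP.mem_ellipse hP.injective⟩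
      fun hT => hab (equilateral a b ha hb _ hP hT)
    refine ⟨h1, h2, hP.center_mem_ellipse ha hb h1 ?_, hP.center_mem_ellipse ha hb h2 ?_, h3⟩
    · simp only [EllipticBilliard.trilinear_zero, EllipticBilliard.trilinear_one,
        EllipticBilliard.trilinear_two, EllipticBilliard.h88]
      ring
    · simp only [EllipticBilliard.trilinear_zero, EllipticBilliard.trilinear_one,
        EllipticBilliard.trilinear_two, EllipticBilliard.h162]
      ring
  refine ⟨fun a b ha hb hab => ⟨periodic a b ha hb hab, fun P hP => ?_⟩, fun T =>
    ⟨EllipticBilliard.coincidenceEquation_iff T, EllipticBilliard.X88_ne_X162 T⟩, equilateral⟩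
  rw [Set.disjoint_left]
  rintro ⟨t, p⟩ h1 h2
  simp only [Set.mem_graphOn, Set.mem_univ, true_and] at h1 h2
  exact (periodic a b ha hb hab (P t) (hP t).1).2.2.2.2 (h1.trans h2.symm)
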